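/- Let $x=(x_1,\dots,x_g)$ and let $\mathbb{R}\langle x\rangle$ be the free algebra of noncommutative real polynomials, with the linear involution determined by $x_i^*=x_i$, $(pq)^*=q^*p^*$; on matrices of polynomials $*$ is the corresponding conjugate transpose, and $p$ is symmetric if $p=p^*$. For a tuple $X$ of real symmetric $n\times n$ matrices and $p=\sum_w A_w\otimes w\in\mathbb{R}^{\nu\times\ell}\langle x\rangle$ put $p(X)=\sum_w A_w\otimes w(X)\in\mathbb{R}^{\nu n\times \ell n}$. Let $\mathbb{R}\langle x\rangle_1$ be the space of polynomials of degree at most $1$. For a left $\mathbb{R}\langle x\rangle$-submodule $I\subseteq\mathbb{R}^{1\times\ell}\langle x\rangle$ let $V(I)$ be the set of pairs $(X,v)$, where $X$ is a $g$-tuple of real symmetric $n\times n$ matrices and $v\in\mathbb{R}^{\ell n}$ ($n$ arbitrary), with $\iota(X)v=0$ for all $\iota\in I$. A linear pencil is a symmetric $L\in\mathbb{R}^{\nu\times\nu}\langle x\rangle$ of degree at most $1$. A right chip space is a subspace $\mathfrak{C}\subseteq\mathbb{R}^{1\times\ell}\langle x\rangle$ spanned by monomials $e_i\otimes w$ such that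 $e_i\otimes w_1w_2w_3,\ e_i\otimes w_3\in\mathfrak{C}$ implies $e_i\otimes w_2w_3\in\mathfrak{C}$. It is finite if it is finite dimensional, and full if $e_i\otimes w_1w_2\in\mathfrak{C}$ implies $e_i\otimes w_2\in\mathfrak{C}$. Products of sets, such as $\mathbb{R}\langle x\rangle_1\mathfrak{C}$ and $\mathfrak{C}^*\mathbb{R}\langle x\rangle_1\mathfrak{C}$, denote the span of the products; $\mathbb{R}^{\nu\times1}S$, for a subspace $S\subseteq\mathbb{R}^{1\times\ell}\langle x\rangle$, is the space of $\nu\times\ell$ matrices all of whose rows are in $S$. A left submodule $J\subseteq\mathbb{R}^{1\times\ell}\langle x\rangle$ is $(L,\mathfrak{C})$-real if, whenever a finite sum $\sum_i p_i^*p_i+\sum_j q_j^*Lq_j$ with $p_i\in\mathfrak{C}$ and $q_j\in\mathbb{R}^{\nu\times1}\mathfrak{C}$ lies in $\mathbb{R}^{\ell\times1}J+J^*\mathbb{R}^{1\times\ell}$, all $p_i\in J$ and all $Lq_j\in\mathbb{R}^{\nu\times1}J$. It is strongly $(L,\mathfrak{C})$-real if in this situation always all $p_i\in J$ and all $q_j\in\mathbb{R}^{\nu\times1}J$.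 The (strong) $(L,\mathfrak{C})$-real radical of $I$ is the intersection of all (strongly) $(L,\mathfrak{C})$-real left submodules containing $I$. **Theorem.** Let $L\in\mathbb{R}^{\nu\times\nu}\langle x\rangle$ be a linear pencil, let $\mathfrak{C}\subseteq\mathbb{R}^{1\times\ell}\langle x\rangle$ be a full finite right chip space, let $I\subseteq\mathbb{R}^{1\times\ell}\langle x\rangle$ be a left $\mathbb{R}\langle x\rangle$-module generated by polynomials in $\mathbb{R}\langle x\rangle_1\mathfrak{C}$, and let $p\in\mathfrak{C}^*\mathbb{R}\langle x\rangle_1\mathfrak{C}$ be symmetric. (1) $v^*p(X)v\ge0$ whenever $(X,v)\in V(I)$ and $L(X)\succeq0$ if and only if $p$ is of the form $$p=\sum_i^{\text{finite}}p_i^*p_i+\sum_j^{\text{finite}}q_j^*Lq_j+\sum_k^{\text{finite}}(r_k^*\iota_k+\iota_k^*r_k)\qquad(*)$$ where each $p_i,r_k\in\mathfrak{C}$, each $q_j\in\mathbb{R}^{\nu\times1}\mathfrak{C}$, and each $\iota_k\in\mathbb{R}\langle x\rangle_1\mathfrak{C}$ lies in the $(L,\mathfrak{C})$-real radical of $I$.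 (2) $v^*p(X)v\ge0$ whenever $(X,v)\in V(I)$ and $L(X)\succ0$ if and only if $p$ is of the form $(*)$ where each $p_i,r_k\in\mathfrak{C}$, each $q_j\in\mathbb{R}^{\nu\times1}\mathfrak{C}$, and each $\iota_k\in\mathbb{R}\langle x\rangle_1\mathfrak{C}$ lies in the strong $(L,\mathfrak{C})$-real radical of $I$. -/

import Mathlib

open Matrix

noncomputable section

namespace SymmNC

/-- The algebra `ℝ⟨x⟩` of noncommutative polynomials in `x = (x₁, …, x_g)`. Its `star` is the
involution of symmetric variables: `x_i* = x_i`, `(pq)* = q* p*`, real scalars are fixed. -/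
abbrev Poly (g : ℕ) : Type := FreeAlgebra ℝ (Fin g)

/-- `ℝ^{ν × ℓ}⟨x⟩`. The involution on it is `Matrix.conjTranspose`. -/
abbrev MPoly (g ν l : ℕ) : Type := Matrix (Fin ν) (Fin l) (Poly g)

/-- The word in the letters `x₁, …, x_g` given by a list of indices. -/
def word {g : ℕ} (w : List (Fin g)) : Poly g := (w.map (FreeAlgebra.ι ℝ)).prod

/-- The monomial `e_i ⊗ w` of `ℝ^{1 × ℓ}⟨x⟩`. -/
def mono {g l : ℕ} (i : Fin l) (w : List (Fin g)) : MPoly g 1 l := Matrix.single 0 i (word w)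

/-- `ℝ⟨x⟩_d`, the polynomials of degree at most `d`. -/
def degLE (g d : ℕ) : Submodule ℝ (Poly g) :=
  Submodule.span ℝ {p | ∃ w : List (Fin g), w.length ≤ d ∧ p = word w}

/-- The `i`-th row of a matrix polynomial, as an element of `ℝ^{1 × ℓ}⟨x⟩`. -/
def rowOf {g ν l : ℕ} (q : MPoly g ν l) (i : Fin ν) : MPoly g 1 l := Matrix.of fun _ j => q i j

/-- `q ∈ ℝ^{ν × 1} S` for a subspace `S` of `ℝ^{1 × ℓ}⟨x⟩`: every row of `q` lies in `S`. -/
def RowsIn {g ν l : ℕ} (S : Set (MPoly g 1 l)) (q : MPoly g ν l) : Prop := ∀ i, rowOf q i ∈ S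

/-- The span `ℝ⟨x⟩_1 C` of all products `d c` with `deg d ≤ 1` and `c ∈ C`. -/
def degOneMul {g l : ℕ} (C : Submodule ℝ (MPoly g 1 l)) : Submodule ℝ (MPoly g 1 l) :=
  Submodule.span ℝ {p | ∃ d ∈ degLE g 1, ∃ c ∈ C, p = d • c}

/-- The span `C* ℝ⟨x⟩_1 C` of all products `b* d c` with `deg d ≤ 1` and `b, c ∈ C`. -/
def starDegOneMul {g l : ℕ} (C : Submodule ℝ (MPoly g 1 l)) : Submodule ℝ (MPoly g l l) :=
  Submodule.span ℝ {p | ∃ b ∈ C, ∃ d ∈ degLE g 1, ∃ c ∈ C, p = bᴴ * (d • c)}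

/-- A linear pencil: a symmetric matrix polynomial of degree at most one. -/
structure IsLinearPencil {g ν : ℕ} (L : MPoly g ν ν) : Prop where
  symm : Lᴴ = L
  deg_le_one : ∀ i j, L i j ∈ degLE g 1

/-- Right chip spaces: spanned by monomials, and if `e_i ⊗ w₁w₂w₃` and `e_i ⊗ w₃` belong to the
space then so does `e_i ⊗ w₂w₃`. -/
structure IsRightChipSpace {g l : ℕ} (C : Submodule ℝ (MPoly g 1 l)) : Prop where
  spanned : ∃ S : Set (Fin l × List (Fin g)), C = Submodule.span ℝ ((fun m => mono m.1 m.2) '' S)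
  chip : ∀ (i : Fin l) (w₁ w₂ w₃ : List (Fin g)),
    mono i (w₁ ++ w₂ ++ w₃) ∈ C → mono i w₃ ∈ C → mono i (w₂ ++ w₃) ∈ C

/-- Fullness: all right chips of the monomials in the space belong to the space. -/
def IsFull {g l : ℕ} (C : Submodule ℝ (MPoly g 1 l)) : Prop :=
  ∀ (i : Fin l) (w₁ w₂ : List (Fin g)), mono i (w₁ ++ w₂) ∈ C → mono i w₂ ∈ C

/-- The value `p(X) = ∑ A_w ⊗ w(X) ∈ ℝ^{νn × ℓn}` of `p = ∑ A_w ⊗ w`. -/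
def evalAt {g ν l n : ℕ} (X : Fin g → Matrix (Fin n) (Fin n) ℝ) (p : MPoly g ν l) :
    Matrix (Fin ν × Fin n) (Fin l × Fin n) ℝ :=
  Matrix.of fun a b => (FreeAlgebra.lift ℝ X (p a.1 b.1)) a.2 b.2

/-- `V(S)^{(n)}`: the pairs `(X, v)` of a tuple of symmetric `n × n` matrices and a vector
`v ∈ ℝ^{ℓn}` with `p(X) v = 0` for every `p ∈ S`. -/
def zeroSet {g l : ℕ} (S : Set (MPoly g 1 l)) (n : ℕ) :
    Set ((Fin g → Matrix (Fin n) (Fin n) ℝ) × (Fin l × Fin n → ℝ)) :=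
  {Xv | (∀ k, (Xv.1 k).IsSymm) ∧ ∀ p ∈ S, evalAt Xv.1 p *ᵥ Xv.2 = 0}

/-- Membership in `ℝ^{ℓ × 1} I + I* ℝ^{1 × ℓ}`. -/
def InRowsAddStar {g l : ℕ} (I : Submodule (Poly g) (MPoly g 1 l)) (p : MPoly g l l) : Prop :=
  ∃ a b : MPoly g l l, RowsIn (I : Set (MPoly g 1 l)) a ∧ RowsIn (I : Set (MPoly g 1 l)) b ∧
    p = a + bᴴ

/-- The left module `I` is `(L, C)`-real. -/
def IsReal {g ν l : ℕ} (L : MPoly g ν ν) (C : Submodule ℝ (MPoly g 1 l))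
    (I : Submodule (Poly g) (MPoly g 1 l)) : Prop :=
  ∀ (a b : ℕ) (P : Fin a → MPoly g 1 l) (Q : Fin b → MPoly g ν l),
    (∀ i, P i ∈ C) → (∀ j, RowsIn (C : Set (MPoly g 1 l)) (Q j)) →
    InRowsAddStar I (∑ i, (P i)ᴴ * P i + ∑ j, (Q j)ᴴ * L * Q j) →
    (∀ i, P i ∈ I) ∧ ∀ j, RowsIn (I : Set (MPoly g 1 l)) (L * Q j)

/-- The left module `I` is strongly `(L, C)`-real. -/
def IsStronglyReal {g ν l : ℕ} (L : MPoly g ν ν) (C : Submodule ℝ (MPoly g 1 l))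
    (I : Submodule (Poly g) (MPoly g 1 l)) : Prop :=
  ∀ (a b : ℕ) (P : Fin a → MPoly g 1 l) (Q : Fin b → MPoly g ν l),
    (∀ i, P i ∈ C) → (∀ j, RowsIn (C : Set (MPoly g 1 l)) (Q j)) →
    InRowsAddStar I (∑ i, (P i)ᴴ * P i + ∑ j, (Q j)ᴴ * L * Q j) →
    (∀ i, P i ∈ I) ∧ ∀ j, RowsIn (I : Set (MPoly g 1 l)) (Q j)

/-- The `(L, C)`-real radical of `I`. -/
def realRadical {g ν l : ℕ} (L : MPoly g ν ν) (C : Submodule ℝ (MPoly g 1 l))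
    (I : Submodule (Poly g) (MPoly g 1 l)) : Submodule (Poly g) (MPoly g 1 l) :=
  sInf {J | I ≤ J ∧ IsReal L C J}

/-- The strong `(L, C)`-real radical of `I`. -/
def strongRealRadical {g ν l : ℕ} (L : MPoly g ν ν) (C : Submodule ℝ (MPoly g 1 l))
    (I : Submodule (Poly g) (MPoly g 1 l)) : Submodule (Poly g) (MPoly g 1 l) :=
  sInf {J | I ≤ J ∧ IsStronglyReal L C J}

/-- `p = ∑ p_i* p_i + ∑ q_j* L q_j + ∑ (r_k* ι_k + ι_k* r_k)` with `p_i, r_k ∈ C`,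
`q_j ∈ ℝ^{ν × 1} C` and `ι_k ∈ J ∩ ℝ⟨x⟩_1 C`. -/
def HasCertificate {g ν l : ℕ} (L : MPoly g ν ν) (C : Submodule ℝ (MPoly g 1 l))
    (J : Submodule (Poly g) (MPoly g 1 l)) (p : MPoly g l l) : Prop :=
  ∃ (a b c : ℕ) (P : Fin a → MPoly g 1 l) (Q : Fin b → MPoly g ν l)
    (R T : Fin c → MPoly g 1 l),
    (∀ i, P i ∈ C) ∧ (∀ j, RowsIn (C : Set (MPoly g 1 l)) (Q j)) ∧ (∀ k, R k ∈ C) ∧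
    (∀ k, T k ∈ J ∧ T k ∈ degOneMul C) ∧
    p = ∑ i, (P i)ᴴ * P i + ∑ j, (Q j)ᴴ * L * Q j + ∑ k, ((R k)ᴴ * T k + (T k)ᴴ * R k)

end SymmNC

end

noncomputable section

namespace SymmNC

/-! Certificates are sound because the annihilator of a point (X, v) of V(I) is a left module
containing I. It is (L, C)-real when L(X) ⪰ 0 and strongly so when L(X) ≻ 0 (`isReal_annihilator`,
`isStronglyReal_annihilator`), so it contains the relevant radical J. The terms with ι_k then vanish
on v, and the others are nonnegative.

Conversely, suppose p has no certificate over J. Modulo the span of the terms b*ι + ι*b, the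
certificates form the cone generated by a quadratic map on a finite-dimensional space. Since J is
itself (strongly) real, a vanishing sum has only trivial terms. Compactness then yields a functional
φ that is negative at p and strictly positive on every nontrivial generator
(`exists_functional_pos_of_quadratic`, `exists_state_of_not_hasCertificate`).

A GNS construction turns φ into a point (`exists_representation_of_state`): φ(b*c) is an inner
product on C modulo J, X consists of the compressed multiplications by the variables, and v comes
from the classes of the e_i. Fullness of C makes c(X)v the class of c for all c in C, so v*p(X)v =
φ(p) < 0. Positivity of φ(q*Lq) becomes positivity of L(X), and the generators of I, having degree
one over C, vanish at (X, v). -/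

/-! ### Convexity: separation from a cone of squares. -/

theorem isCompact_convexHull_of_isCompact {E : Type*} [NormedAddCommGroup E] [NormedSpace ℝ E]
    [FiniteDimensional ℝ E] {A : Set E} (hA : IsCompact A) : IsCompact (convexHull ℝ A) := by
  have key : convexHull ℝ A = ⋃ n ∈ Set.Iic (Module.finrank ℝ E + 1),
      (fun q : (Fin n → ℝ) × (Fin n → E) => ∑ i, q.1 i • q.2 i) ''
        (stdSimplex ℝ (Fin n) ×ˢ Set.univ.pi fun _ => A) := by
    ext x
    simp only [Set.mem_iUnion, Set.mem_Iic, Set.mem_image, Prod.exists, Set.mem_prod,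
      Set.mem_univ_pi, exists_prop]
    constructor
    · intro hx
      obtain ⟨ι, _, z, w, hz, hind, hw, hw1, rfl⟩ := eq_pos_convex_span_of_mem_convexHull hx
      refine ⟨Fintype.card ι, hind.card_le_finrank_succ.trans
        (Nat.succ_le_succ (Submodule.finrank_le _)), w ∘ (Fintype.equivFin ι).symm,
        z ∘ (Fintype.equivFin ι).symm, ⟨⟨fun i => (hw _).le, ?_⟩, fun i => hz ⟨_, rfl⟩⟩, ?_⟩
      · exact ((Fintype.equivFin ι).symm.sum_comp w).trans hw1
      · exact (Fintype.equivFin ι).symm.sum_comp fun i => w i • z i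
    · rintro ⟨n, -, w, z, ⟨hw, hz⟩, rfl⟩
      exact mem_convexHull_iff_exists_fintype.2 ⟨_, inferInstance, w, z, hw.1, hw.2, hz, rfl⟩
  rw [key]
  refine (Set.finite_Iic _).isCompact_biUnion fun n _ => ?_
  exact ((isCompact_stdSimplex ℝ _).prod (isCompact_univ_pi fun _ => hA)).image (by fun_prop)

/-- `B v v` depends only on `v` modulo `K`, and no nontrivial sum of such values vanishes. The
squares of unit vectors in a complement of `K` are compact, so a strict separation from 0 gives
strict positivity everywhere off `K`. -/
theorem exists_functional_pos_of_quadratic {V F : Type*} [AddCommGroup V] [Module ℝ V]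
    [FiniteDimensional ℝ V] [AddCommGroup F] [Module ℝ F] (B : V →ₗ[ℝ] V →ₗ[ℝ] F)
    (K : Submodule ℝ V) (hK : ∀ v, ∀ k ∈ K, B (v + k) (v + k) = B v v)
    (hpos : ∀ (n : ℕ) (v : Fin n → V), ∑ i, B (v i) (v i) = 0 → ∀ i, v i ∈ K)
    (p : F) (hp : ∀ (n : ℕ) (v : Fin n → V), p ≠ ∑ i, B (v i) (v i)) :
    ∃ φ : F →ₗ[ℝ] ℝ, (∀ v, v ∉ K → 0 < φ (B v v)) ∧ φ p < 0 := by
  obtain ⟨U, hU⟩ := K.exists_isCompl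
  let e : (Fin (Module.finrank ℝ U) → ℝ) ≃ₗ[ℝ] U := (Module.finBasis ℝ U).equivFun.symm
  let b : Fin (Module.finrank ℝ U) → V := fun i => (Module.finBasis ℝ U i : V)
  have he : ∀ t, ((e t : U) : V) = ∑ i, t i • b i := by
    intro t
    simp [e, b, Module.Basis.equivFun_symm_apply]
  let G : Fin (Module.finrank ℝ U) × Fin (Module.finrank ℝ U) → F := fun ij => B (b ij.1) (b ij.2)
  let F₀ : Submodule ℝ F := Submodule.span ℝ (Set.range G ∪ {p})
  have : FiniteDimensional ℝ F₀ :=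
    FiniteDimensional.span_of_finite ℝ ((Set.finite_range G).union (Set.finite_singleton p))
  have hG : ∀ ij, G ij ∈ F₀ := fun ij => Submodule.subset_span (Or.inl ⟨ij, rfl⟩)
  have hpF : p ∈ F₀ := Submodule.subset_span (Or.inr rfl)
  let ψ : F₀ ≃ₗ[ℝ] (Fin (Module.finrank ℝ F₀) → ℝ) := (Module.finBasis ℝ F₀).equivFun
  let f : (Fin (Module.finrank ℝ U) → ℝ) → (Fin (Module.finrank ℝ F₀) → ℝ) :=
    fun t => ∑ i, ∑ j, (t i * t j) • ψ ⟨G (i, j), hG _⟩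
  have hf : Continuous f := by fun_prop
  have hfB : ∀ t, ((ψ.symm (f t) : F₀) : F) = B (e t) (e t) := by
    intro t
    simp only [f, map_sum, map_smul, LinearEquiv.symm_apply_apply, Submodule.coe_sum,
      Submodule.coe_smul, he, LinearMap.sum_apply, LinearMap.smul_apply, G, Finset.smul_sum,
      smul_smul]
    rw [Finset.sum_comm]
    exact Finset.sum_congr rfl fun i _ => Finset.sum_congr rfl fun j _ => by rw [mul_comm]
  have hscale : ∀ (c : ℝ) t, f (c • t) = (c * c) • f t := by
    intro c t
    simp only [f, Finset.smul_sum, smul_smul, Pi.smul_apply, smul_eq_mul]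
    exact Finset.sum_congr rfl fun i _ => Finset.sum_congr rfl fun j _ => by ring_nf
  have hmemK : ∀ t, ((e t : U) : V) ∈ K → t = 0 := by
    intro t ht
    have : ((e t : U) : V) ∈ K ⊓ U := ⟨ht, (e t).2⟩
    rw [hU.inf_eq_bot, Submodule.mem_bot] at this
    simpa using this
  have hpos' : ∀ {ι : Type} [Fintype ι] (t : ι → Fin (Module.finrank ℝ U) → ℝ),
      ∑ i, f (t i) = 0 → ∀ i, t i = 0 := by
    intro ι _ t h i
    refine hmemK _ ?_
    have := hpos (Fintype.card ι) (fun k => (e (t ((Fintype.equivFin ι).symm k)) : V)) ?_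
      (Fintype.equivFin ι i)
    · simpa using this
    · rw [(Fintype.equivFin ι).symm.sum_comp (fun i => B (e (t i)) (e (t i)))]
      simp only [← hfB, ← Submodule.coe_sum, ← map_sum, h, map_zero, Submodule.coe_zero]
  have hp' : ∀ {ι : Type} [Fintype ι] (t : ι → Fin (Module.finrank ℝ U) → ℝ),
      ψ ⟨p, hpF⟩ ≠ ∑ i, f (t i) := by
    intro ι _ t h
    refine hp (Fintype.card ι) (fun k => (e (t ((Fintype.equivFin ι).symm k)) : V)) ?_
    rw [(Fintype.equivFin ι).symm.sum_comp (fun i => B (e (t i)) (e (t i)))]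
    simp only [← hfB, ← Submodule.coe_sum, ← map_sum, ← h, LinearEquiv.symm_apply_apply]
  -- Including `-p` lets a single separation from 0 produce both positivity on the squares and
  -- negativity at `p`.
  have hcompact : IsCompact (insert (-ψ ⟨p, hpF⟩) (f '' Metric.sphere 0 1)) :=
    ((isCompact_sphere 0 1).image hf).insert _
  have hzero : (0 : Fin (Module.finrank ℝ F₀) → ℝ) ∉
      convexHull ℝ (insert (-ψ ⟨p, hpF⟩) (f '' Metric.sphere 0 1)) := by
    intro h0
    obtain ⟨ι, _, w, z, hw0, hw1, hz, hsum⟩ := mem_convexHull_iff_exists_fintype.1 h0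
    -- Square roots absorb the convex weights into the vectors, turning the vanishing convex
    -- combination into an identity `∑ f (t i) = (∑ s i) • p`. The last clause remembers that
    -- trivial data means zero weight.
    have hchoice : ∀ i, ∃ (s : ℝ) (t : Fin (Module.finrank ℝ U) → ℝ), 0 ≤ s ∧
        w i • z i = f t - s • ψ ⟨p, hpF⟩ ∧ (s = 0 → t = 0 → w i = 0) := by
      intro i
      rcases hz i with h | ⟨t, ht, h⟩
      · refine ⟨w i, 0, hw0 i, ?_, fun h _ => h⟩
        have : f 0 = 0 := by simp [f]
        rw [h, this]; simp
      · refine ⟨0, √(w i) • t, le_rfl, ?_, fun _ h => ?_⟩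
        · rw [hscale, Real.mul_self_sqrt (hw0 i), h]; simp
        · rcases smul_eq_zero.1 h with h | h
          · exact (Real.sqrt_eq_zero (hw0 i)).1 h
          · simp [h] at ht
    choose s t hs hst hsw using hchoice
    simp only [hst, Finset.sum_sub_distrib, ← Finset.sum_smul, sub_eq_zero] at hsum
    -- If the coefficient of `p` is zero, all vectors vanish and the weights cannot sum to 1;
    -- otherwise dividing by it makes `p` a sum of squares.
    rcases (Finset.sum_nonneg fun i _ => hs i : 0 ≤ ∑ i, s i).eq_or_lt with h | h
    · have ht := hpos' t (by rw [hsum, ← h, zero_smul])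
      have hs0 := (Finset.sum_eq_zero_iff_of_nonneg fun i _ => hs i).1 h.symm
      have : ∑ i, w i = 0 :=
        Finset.sum_eq_zero fun i hi => hsw i (hs0 i hi) (ht i)
      linarith
    · refine hp' (fun i => √((∑ i, s i)⁻¹) • t i) ?_
      simp only [hscale, Real.mul_self_sqrt (inv_nonneg.2 h.le), ← Finset.smul_sum, hsum,
        smul_smul, inv_mul_cancel₀ h.ne', one_smul]
  obtain ⟨ℓ, u, hu0, hu⟩ := geometric_hahn_banach_point_closed (convex_convexHull ℝ _)
    (isCompact_convexHull_of_isCompact hcompact).isClosed hzero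
  rw [map_zero] at hu0
  have hpositive : ∀ y ∈ insert (-ψ ⟨p, hpF⟩) (f '' Metric.sphere 0 1), 0 < ℓ y :=
    fun y hy => hu0.trans (hu y (subset_convexHull ℝ _ hy))
  obtain ⟨φ, hφ⟩ := LinearMap.exists_extend (ℓ.toLinearMap ∘ₗ ψ.toLinearMap)
  have hφ' : ∀ y : F₀, φ y = ℓ (ψ y) := fun y => LinearMap.congr_fun hφ y
  refine ⟨φ, fun v hv => ?_, ?_⟩
  · obtain ⟨k, hk, y, hy, rfl⟩ := Submodule.mem_sup.1
      (hU.sup_eq_top ▸ Submodule.mem_top : v ∈ K ⊔ U)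
    rw [add_comm, hK _ _ hk]
    have hyK : y ∉ K := fun h => hv (K.add_mem hk h)
    have hne : e.symm ⟨y, hy⟩ ≠ 0 := by
      intro h
      apply hyK
      have : (⟨y, hy⟩ : U) = 0 := by simpa using h
      rw [show y = 0 from congrArg Subtype.val this]
      exact K.zero_mem
    have hy' : B y y = (ψ.symm (f (e.symm ⟨y, hy⟩)) : F₀) := by rw [hfB]; simp
    rw [hy', hφ', LinearEquiv.apply_symm_apply]
    have hn := norm_pos_iff.2 hne
    have : e.symm ⟨y, hy⟩ = ‖e.symm ⟨y, hy⟩‖ • (‖e.symm ⟨y, hy⟩‖⁻¹ • e.symm ⟨y, hy⟩) := by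
      rw [smul_smul, mul_inv_cancel₀ hn.ne', one_smul]
    rw [this, hscale, map_smul, smul_eq_mul]
    refine mul_pos (mul_pos hn hn) (hpositive _ (Or.inr ⟨_, ?_, rfl⟩))
    simp [norm_smul, hn.ne']
  · have := hpositive _ (Or.inl rfl)
    rw [map_neg] at this
    have h2 := hφ' ⟨p, hpF⟩
    simp only at h2
    linarith

theorem exists_orthonormal_basis_of_pos {V : Type*} [AddCommGroup V] [Module ℝ V]
    [FiniteDimensional ℝ V] (B : LinearMap.BilinForm ℝ V) (hsymm : ∀ x y, B x y = B y x)
    (hpos : ∀ x, x ≠ 0 → 0 < B x x) :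
    ∃ (n : ℕ) (b : Module.Basis (Fin n) ℝ V), ∀ i j, B (b i) (b j) = if i = j then 1 else 0 := by
  obtain ⟨b, hb⟩ := LinearMap.BilinForm.exists_orthogonal_basis (B := B) ⟨fun x y => by simp [hsymm x y]⟩
  have hbp : ∀ i, 0 < B (b i) (b i) := fun i => hpos _ (b.ne_zero i)
  refine ⟨_, b.isUnitSMul (w := fun i => (√(B (b i) (b i)))⁻¹)
    fun i => (inv_ne_zero (Real.sqrt_ne_zero'.2 (hbp i))).isUnit, fun i j => ?_⟩
  simp only [Module.Basis.isUnitSMul_apply, map_smul, LinearMap.smul_apply, smul_eq_mul]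
  split_ifs with h
  · subst h
    rw [← mul_assoc, ← mul_inv, Real.mul_self_sqrt (hbp i).le, inv_mul_cancel₀ (hbp i).ne']
  · have : B (b i) (b j) = 0 := hb h
    simp [this]

/-! ### Evaluation at symmetric matrix tuples. -/

variable {g ν l n : ℕ}

instance : StarModule ℝ (Poly g) where
  star_smul r a := by
    simp [Algebra.smul_def, Algebra.commutes]

theorem lift_star {X : Fin g → Matrix (Fin n) (Fin n) ℝ} (hX : ∀ k, (X k).IsSymm) (a : Poly g) :
    FreeAlgebra.lift ℝ X (star a) = (FreeAlgebra.lift ℝ X a)ᵀ := by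
  induction a using FreeAlgebra.induction with
  | grade0 r => simp [Matrix.algebraMap_eq_diagonal]
  | grade1 k => simp [(hX k).eq]
  | mul a b ha hb => simp [ha, hb]
  | add a b ha hb => simp [ha, hb]

theorem evalAt_add (X : Fin g → Matrix (Fin n) (Fin n) ℝ) (p q : MPoly g ν l) :
    evalAt X (p + q) = evalAt X p + evalAt X q := by
  ext a b; simp [evalAt]

theorem evalAt_smul (X : Fin g → Matrix (Fin n) (Fin n) ℝ) (r : ℝ) (p : MPoly g ν l) :
    evalAt X (r • p) = r • evalAt X p := by
  ext a b; simp [evalAt]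

theorem evalAt_zero (X : Fin g → Matrix (Fin n) (Fin n) ℝ) :
    evalAt X (0 : MPoly g ν l) = 0 := by
  ext a b; simp [evalAt]

theorem evalAt_sum (X : Fin g → Matrix (Fin n) (Fin n) ℝ) {ι : Type*} (s : Finset ι)
    (p : ι → MPoly g ν l) : evalAt X (∑ i ∈ s, p i) = ∑ i ∈ s, evalAt X (p i) :=
  map_sum (AddMonoidHom.mk' (evalAt X) (evalAt_add X)) p s

theorem evalAt_mul (X : Fin g → Matrix (Fin n) (Fin n) ℝ) {μ : ℕ} (p : MPoly g ν μ)
    (q : MPoly g μ l) : evalAt X (p * q) = evalAt X p * evalAt X q := by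
  ext a b
  simp [evalAt, Matrix.mul_apply, Fintype.sum_prod_type, Matrix.sum_apply]

theorem evalAt_conjTranspose {X : Fin g → Matrix (Fin n) (Fin n) ℝ} (hX : ∀ k, (X k).IsSymm)
    (p : MPoly g ν l) : evalAt X pᴴ = (evalAt X p)ᵀ := by
  ext a b
  simp [evalAt, lift_star hX]

theorem evalAt_mulVec_apply (X : Fin g → Matrix (Fin n) (Fin n) ℝ) (p : MPoly g ν l)
    (v : Fin l × Fin n → ℝ) (a : Fin ν) (m : Fin n) :
    (evalAt X p *ᵥ v) (a, m) =
      ∑ i, (FreeAlgebra.lift ℝ X (p a i) *ᵥ fun k => v (i, k)) m := by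
  simp [evalAt, Matrix.mulVec, dotProduct, Fintype.sum_prod_type]

theorem evalAt_rowOf_mulVec (X : Fin g → Matrix (Fin n) (Fin n) ℝ) (p : MPoly g ν l)
    (v : Fin l × Fin n → ℝ) (a : Fin ν) (m : Fin n) :
    (evalAt X (rowOf p a) *ᵥ v) (0, m) = (evalAt X p *ᵥ v) (a, m) := by
  simp [evalAt_mulVec_apply, rowOf]

theorem dotProduct_evalAt_conjTranspose_mul {X : Fin g → Matrix (Fin n) (Fin n) ℝ}
    (hX : ∀ k, (X k).IsSymm) (a b : MPoly g ν l) (v : Fin l × Fin n → ℝ) :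
    v ⬝ᵥ (evalAt X (aᴴ * b) *ᵥ v) = (evalAt X a *ᵥ v) ⬝ᵥ (evalAt X b *ᵥ v) := by
  rw [evalAt_mul, evalAt_conjTranspose hX, ← Matrix.mulVec_mulVec, Matrix.dotProduct_mulVec,
    Matrix.vecMul_transpose]

theorem dotProduct_evalAt_conjTranspose {X : Fin g → Matrix (Fin n) (Fin n) ℝ}
    (hX : ∀ k, (X k).IsSymm) (a : MPoly g l l) (v : Fin l × Fin n → ℝ) :
    v ⬝ᵥ (evalAt X aᴴ *ᵥ v) = v ⬝ᵥ (evalAt X a *ᵥ v) := by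
  rw [evalAt_conjTranspose hX, Matrix.dotProduct_mulVec, Matrix.vecMul_transpose, dotProduct_comm]

/-- The vector `c(X) v ∈ ℝⁿ`, as a linear function of the row `c`. -/
def act (X : Fin g → Matrix (Fin n) (Fin n) ℝ) (v : Fin l × Fin n → ℝ) :
    MPoly g 1 l →ₗ[ℝ] (Fin n → ℝ) where
  toFun c m := (evalAt X c *ᵥ v) (0, m)
  map_add' a b := by ext m; simp [evalAt_add, Matrix.add_mulVec]
  map_smul' r a := by ext m; simp [evalAt_smul, Matrix.smul_mulVec]

theorem act_apply (X : Fin g → Matrix (Fin n) (Fin n) ℝ) (v : Fin l × Fin n → ℝ)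
    (c : MPoly g 1 l) (m : Fin n) : act X v c m = (evalAt X c *ᵥ v) (0, m) := rfl

theorem act_eq_zero_iff {X : Fin g → Matrix (Fin n) (Fin n) ℝ} {v : Fin l × Fin n → ℝ}
    {c : MPoly g 1 l} : act X v c = 0 ↔ evalAt X c *ᵥ v = 0 := by
  refine ⟨fun h => ?_, fun h => ?_⟩
  · ext ⟨i, m⟩
    obtain rfl : i = 0 := Subsingleton.elim _ _
    exact congrFun h m
  · ext m
    exact congrFun h (0, m)

theorem act_polySmul (X : Fin g → Matrix (Fin n) (Fin n) ℝ) (v : Fin l × Fin n → ℝ) (d : Poly g)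
    (c : MPoly g 1 l) : act X v (d • c) = FreeAlgebra.lift ℝ X d *ᵥ act X v c := by
  ext m
  have : act X v c = ∑ i, (FreeAlgebra.lift ℝ X (c 0 i) *ᵥ fun k => v (i, k)) := by
    ext m
    rw [act_apply, evalAt_mulVec_apply, Finset.sum_apply]
  rw [this, act_apply, evalAt_mulVec_apply, Matrix.mulVec_sum, Finset.sum_apply]
  simp [Matrix.mulVec_mulVec]

theorem act_mono_nil (X : Fin g → Matrix (Fin n) (Fin n) ℝ) (v : Fin l × Fin n → ℝ) (i : Fin l) :
    act X v (mono i []) = fun m => v (i, m) := by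
  ext m
  rw [act_apply, evalAt_mulVec_apply, Finset.sum_eq_single i]
  · simp [mono, word]
  · intro j _ hj
    simp [mono, hj.symm]
  · simp

theorem mono_cons (i : Fin l) (k : Fin g) (w : List (Fin g)) :
    mono i (k :: w) = (FreeAlgebra.ι ℝ k : Poly g) • mono i w := by
  simp [mono, word]

/-! ### Annihilators of points and soundness of certificates. -/

/-- The left module of all rows `c` with `c(X) v = 0`. -/
def annihilator (X : Fin g → Matrix (Fin n) (Fin n) ℝ) (v : Fin l × Fin n → ℝ) :
    Submodule (Poly g) (MPoly g 1 l) where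
  carrier := {c | act X v c = 0}
  add_mem' ha hb := by simp_all
  zero_mem' := by simp
  smul_mem' d c hc := by simp_all [act_polySmul]

theorem mem_annihilator {X : Fin g → Matrix (Fin n) (Fin n) ℝ} {v : Fin l × Fin n → ℝ}
    {c : MPoly g 1 l} : c ∈ annihilator X v ↔ evalAt X c *ᵥ v = 0 :=
  act_eq_zero_iff

theorem rowsIn_annihilator {X : Fin g → Matrix (Fin n) (Fin n) ℝ} {v : Fin l × Fin n → ℝ}
    {q : MPoly g ν l} :
    RowsIn (annihilator X v : Set (MPoly g 1 l)) q ↔ evalAt X q *ᵥ v = 0 := by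
  constructor
  · intro h
    ext ⟨a, m⟩
    rw [← evalAt_rowOf_mulVec, mem_annihilator.1 (h a)]
    rfl
  · intro h a
    refine mem_annihilator.2 (act_eq_zero_iff.1 ?_)
    ext m
    rw [act_apply, evalAt_rowOf_mulVec, h]
    rfl

theorem InRowsAddStar.dotProduct_eq_zero {X : Fin g → Matrix (Fin n) (Fin n) ℝ}
    (hX : ∀ k, (X k).IsSymm) {v : Fin l × Fin n → ℝ} {s : MPoly g l l}
    (hs : InRowsAddStar (annihilator X v) s) : v ⬝ᵥ (evalAt X s *ᵥ v) = 0 := by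
  obtain ⟨a, b, ha, hb, rfl⟩ := hs
  rw [evalAt_add, Matrix.add_mulVec, dotProduct_add, dotProduct_evalAt_conjTranspose hX,
    rowsIn_annihilator.1 ha, rowsIn_annihilator.1 hb]
  simp

theorem dotProduct_evalAt_sum_squares {X : Fin g → Matrix (Fin n) (Fin n) ℝ}
    (hX : ∀ k, (X k).IsSymm) (v : Fin l × Fin n → ℝ) (L : MPoly g ν ν) {a b : ℕ}
    (P : Fin a → MPoly g 1 l) (Q : Fin b → MPoly g ν l) :
    v ⬝ᵥ (evalAt X (∑ i, (P i)ᴴ * P i + ∑ j, (Q j)ᴴ * L * Q j) *ᵥ v) =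
      ∑ i, (evalAt X (P i) *ᵥ v) ⬝ᵥ (evalAt X (P i) *ᵥ v) +
      ∑ j, (evalAt X (Q j) *ᵥ v) ⬝ᵥ (evalAt X L *ᵥ (evalAt X (Q j) *ᵥ v)) := by
  simp only [evalAt_add, evalAt_sum, Matrix.add_mulVec, Matrix.sum_mulVec, dotProduct_add,
    dotProduct_sum, Matrix.mul_assoc, dotProduct_evalAt_conjTranspose_mul hX]
  simp only [evalAt_mul, Matrix.mulVec_mulVec]

theorem terms_eq_zero_of_inRowsAddStar_annihilator {X : Fin g → Matrix (Fin n) (Fin n) ℝ}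
    (hX : ∀ k, (X k).IsSymm) {v : Fin l × Fin n → ℝ} {L : MPoly g ν ν}
    (hLX : (evalAt X L).PosSemidef) {a b : ℕ} {P : Fin a → MPoly g 1 l} {Q : Fin b → MPoly g ν l}
    (h : InRowsAddStar (annihilator X v) (∑ i, (P i)ᴴ * P i + ∑ j, (Q j)ᴴ * L * Q j)) :
    (∀ i, P i ∈ annihilator X v) ∧
      ∀ j, (evalAt X (Q j) *ᵥ v) ⬝ᵥ (evalAt X L *ᵥ (evalAt X (Q j) *ᵥ v)) = 0 := by
  have h0 := h.dotProduct_eq_zero hX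
  rw [dotProduct_evalAt_sum_squares hX] at h0
  have h1 : ∀ i ∈ Finset.univ, 0 ≤ (evalAt X (P i) *ᵥ v) ⬝ᵥ (evalAt X (P i) *ᵥ v) :=
    fun i _ => Finset.sum_nonneg fun k _ => mul_self_nonneg _
  have h2 : ∀ j ∈ Finset.univ,
      0 ≤ (evalAt X (Q j) *ᵥ v) ⬝ᵥ (evalAt X L *ᵥ (evalAt X (Q j) *ᵥ v)) :=
    fun j _ => by simpa using hLX.dotProduct_mulVec_nonneg (evalAt X (Q j) *ᵥ v)
  obtain ⟨h3, h4⟩ := (add_eq_zero_iff_of_nonneg (Finset.sum_nonneg h1) (Finset.sum_nonneg h2)).1 h0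
  exact ⟨fun i => mem_annihilator.2 (dotProduct_self_eq_zero.1
    ((Finset.sum_eq_zero_iff_of_nonneg h1).1 h3 i (Finset.mem_univ i))),
    fun j => (Finset.sum_eq_zero_iff_of_nonneg h2).1 h4 j (Finset.mem_univ j)⟩

/-- For L(X) ⪰ 0, the vanishing of w*L(X)w forces only L(X)w = 0, not w = 0; hence `L * Q j` in the
conclusion. -/
theorem isReal_annihilator {X : Fin g → Matrix (Fin n) (Fin n) ℝ}
    (hX : ∀ k, (X k).IsSymm) (v : Fin l × Fin n → ℝ) {L : MPoly g ν ν}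
    (hLX : (evalAt X L).PosSemidef) (C : Submodule ℝ (MPoly g 1 l)) :
    IsReal L C (annihilator X v) := by
  intro a b P Q _ _ h
  obtain ⟨h1, h2⟩ := terms_eq_zero_of_inRowsAddStar_annihilator hX hLX h
  refine ⟨h1, fun j => rowsIn_annihilator.2 ?_⟩
  rw [evalAt_mul, ← Matrix.mulVec_mulVec]
  exact (hLX.dotProduct_mulVec_zero_iff _).1 (by simpa using h2 j)

theorem isStronglyReal_annihilator {X : Fin g → Matrix (Fin n) (Fin n) ℝ}
    (hX : ∀ k, (X k).IsSymm) (v : Fin l × Fin n → ℝ) {L : MPoly g ν ν}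
    (hLX : (evalAt X L).PosDef) (C : Submodule ℝ (MPoly g 1 l)) :
    IsStronglyReal L C (annihilator X v) := by
  intro a b P Q _ _ h
  obtain ⟨h1, h2⟩ := terms_eq_zero_of_inRowsAddStar_annihilator hX hLX.posSemidef h
  refine ⟨h1, fun j => rowsIn_annihilator.2 ?_⟩
  by_contra hne
  have := hLX.dotProduct_mulVec_pos hne
  rw [star_trivial, h2 j] at this
  exact this.false

theorem HasCertificate.dotProduct_nonneg {X : Fin g → Matrix (Fin n) (Fin n) ℝ}
    (hX : ∀ k, (X k).IsSymm) {v : Fin l × Fin n → ℝ} {L : MPoly g ν ν}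
    (hLX : (evalAt X L).PosSemidef) {C : Submodule ℝ (MPoly g 1 l)}
    {J : Submodule (Poly g) (MPoly g 1 l)} (hJ : J ≤ annihilator X v) {p : MPoly g l l}
    (h : HasCertificate L C J p) : 0 ≤ v ⬝ᵥ (evalAt X p *ᵥ v) := by
  obtain ⟨a, b, c, P, Q, R, T, -, -, -, hT, rfl⟩ := h
  rw [evalAt_add, Matrix.add_mulVec, dotProduct_add, dotProduct_evalAt_sum_squares hX]
  have h1 : v ⬝ᵥ (evalAt X (∑ k, ((R k)ᴴ * T k + (T k)ᴴ * R k)) *ᵥ v) = 0 := by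
    simp only [evalAt_add, evalAt_sum, Matrix.add_mulVec, Matrix.sum_mulVec, dotProduct_add,
      dotProduct_sum, dotProduct_evalAt_conjTranspose_mul hX]
    refine Finset.sum_eq_zero fun k _ => ?_
    rw [mem_annihilator.1 (hJ (hT k).1)]
    simp
  rw [h1, add_zero]
  refine add_nonneg (Finset.sum_nonneg fun i _ => Finset.sum_nonneg fun k _ => mul_self_nonneg _)
    (Finset.sum_nonneg fun j _ => ?_)
  simpa using hLX.dotProduct_mulVec_nonneg (evalAt X (Q j) *ᵥ v)

/-! ### Radicals are themselves real. -/

theorem InRowsAddStar.mono {I J : Submodule (Poly g) (MPoly g 1 l)} (h : I ≤ J) {s : MPoly g l l}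
    (hs : InRowsAddStar I s) : InRowsAddStar J s := by
  obtain ⟨a, b, ha, hb, rfl⟩ := hs
  exact ⟨a, b, fun i => h (ha i), fun i => h (hb i), rfl⟩

theorem isReal_realRadical (L : MPoly g ν ν) (C : Submodule ℝ (MPoly g 1 l))
    (I : Submodule (Poly g) (MPoly g 1 l)) : IsReal L C (realRadical L C I) := by
  intro a b P Q hP hQ h
  have key : ∀ J ∈ {J | I ≤ J ∧ IsReal L C J}, _ := fun J hJ =>
    hJ.2 a b P Q hP hQ (h.mono (sInf_le hJ))
  exact ⟨fun i => (Submodule.mem_sInf).2 fun J hJ => (key J hJ).1 i,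
    fun j k => (Submodule.mem_sInf).2 fun J hJ => (key J hJ).2 j k⟩

theorem isStronglyReal_strongRealRadical (L : MPoly g ν ν) (C : Submodule ℝ (MPoly g 1 l))
    (I : Submodule (Poly g) (MPoly g 1 l)) : IsStronglyReal L C (strongRealRadical L C I) := by
  intro a b P Q hP hQ h
  have key : ∀ J ∈ {J | I ≤ J ∧ IsStronglyReal L C J}, _ := fun J hJ =>
    hJ.2 a b P Q hP hQ (h.mono (sInf_le hJ))
  exact ⟨fun i => (Submodule.mem_sInf).2 fun J hJ => (key J hJ).1 i,
    fun j k => (Submodule.mem_sInf).2 fun J hJ => (key J hJ).2 j k⟩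

/-! ### Degree-one products and row calculus. -/

theorem one_mem_degLE : (1 : Poly g) ∈ degLE g 1 :=
  Submodule.subset_span ⟨[], by simp, by simp [word]⟩

theorem ι_mem_degLE (k : Fin g) : (FreeAlgebra.ι ℝ k : Poly g) ∈ degLE g 1 :=
  Submodule.subset_span ⟨[k], by simp, by simp [word]⟩

theorem degLE_one_induction {motive : Poly g → Prop} (one : motive 1)
    (var : ∀ k, motive (FreeAlgebra.ι ℝ k)) (add : ∀ a b, motive a → motive b → motive (a + b))
    (smul : ∀ (r : ℝ) a, motive a → motive (r • a)) {d : Poly g} (hd : d ∈ degLE g 1) :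
    motive d := by
  induction hd using Submodule.span_induction with
  | mem x h =>
    obtain ⟨w, hw, rfl⟩ := h
    match w, hw with
    | [], _ => simpa [word] using one
    | [k], _ => simpa [word] using var k
  | zero => simpa using smul 0 1 one
  | add x y _ _ hx hy => exact add x y hx hy
  | smul r x _ hx => exact smul r x hx

theorem star_mem_degLE_one {d : Poly g} (hd : d ∈ degLE g 1) : star d ∈ degLE g 1 := by
  refine degLE_one_induction (motive := fun d => star d ∈ degLE g 1) ?_ (fun k => ?_)
    (fun a b ha hb => ?_) (fun r a ha => ?_) hd
  · simpa using one_mem_degLE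
  · simpa using ι_mem_degLE k
  · simpa using Submodule.add_mem _ ha hb
  · simpa [star_smul] using Submodule.smul_mem _ r ha

theorem smul_mem_degOneMul {C : Submodule ℝ (MPoly g 1 l)} {d : Poly g} (hd : d ∈ degLE g 1)
    {c : MPoly g 1 l} (hc : c ∈ C) : d • c ∈ degOneMul C :=
  Submodule.subset_span ⟨d, hd, c, hc, rfl⟩

theorem le_degOneMul (C : Submodule ℝ (MPoly g 1 l)) : C ≤ degOneMul C := fun c hc => by
  simpa using smul_mem_degOneMul one_mem_degLE hc

theorem conjTranspose_smul_mul (d : Poly g) (c b : MPoly g 1 l) :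
    (d • c)ᴴ * b = cᴴ * (star d • b) := by
  ext i j
  simp [Matrix.mul_apply, mul_assoc]

theorem conjTranspose_mul_eq_sum_rowOf (b c : MPoly g ν l) :
    bᴴ * c = ∑ a, (rowOf b a)ᴴ * rowOf c a := by
  ext i j
  simp [Matrix.mul_apply, rowOf, Matrix.sum_apply]

theorem rowOf_mul (L : MPoly g ν ν) (q : MPoly g ν l) (a : Fin ν) :
    rowOf (L * q) a = ∑ b, L a b • rowOf q b := by
  ext i j
  simp [Matrix.mul_apply, rowOf, Matrix.sum_apply]

theorem rowsIn_degOneMul_mul {L : MPoly g ν ν} (hL : IsLinearPencil L)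
    {C : Submodule ℝ (MPoly g 1 l)} {q : MPoly g ν l} (hq : RowsIn (C : Set (MPoly g 1 l)) q) :
    RowsIn (degOneMul C : Set (MPoly g 1 l)) (L * q) := by
  intro a
  rw [rowOf_mul]
  exact Submodule.sum_mem _ fun b _ => smul_mem_degOneMul (hL.deg_le_one a b) (hq b)

/-! ### The GNS construction. -/

/-- The bilinear form `(a, b) ↦ φ (a* b)`. -/
def starForm (φ : MPoly g l l →ₗ[ℝ] ℝ) : MPoly g ν l →ₗ[ℝ] MPoly g ν l →ₗ[ℝ] ℝ :=
  LinearMap.mk₂ ℝ (fun a b => φ (aᴴ * b))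
    (by simp [Matrix.add_mul]) (by simp) (by simp [Matrix.mul_add]) (by simp)

theorem starForm_apply (φ : MPoly g l l →ₗ[ℝ] ℝ) (a b : MPoly g ν l) :
    starForm φ a b = φ (aᴴ * b) := rfl

theorem exists_orthonormal_modulo {M : Type*} [AddCommGroup M] [Module ℝ M]
    (B : M →ₗ[ℝ] M →ₗ[ℝ] ℝ) (hsymm : ∀ x y, B x y = B y x) (C J : Submodule ℝ M)
    [FiniteDimensional ℝ C] (hJ : ∀ b ∈ C, ∀ c ∈ C, c ∈ J → B b c = 0)
    (hpos : ∀ c ∈ C, c ∉ J → 0 < B c c) :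
    ∃ (n : ℕ) (u : Fin n → M), (∀ m, u m ∈ C) ∧ (∀ i j, B (u i) (u j) = if i = j then 1 else 0) ∧
      ∀ c ∈ C, c - ∑ m, B (u m) c • u m ∈ J := by
  obtain ⟨U, hU⟩ := (J.comap C.subtype).exists_isCompl
  let f : U →ₗ[ℝ] M := C.subtype ∘ₗ U.subtype
  have hfC : ∀ x, f x ∈ C := fun x => (x : C).2
  obtain ⟨n, b, hb⟩ := exists_orthonormal_basis_of_pos (B.compl₁₂ f f)
    (fun x y => hsymm _ _) (fun x hx => hpos _ (hfC x) fun hxJ => hx (by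
      have : (x : C) ∈ J.comap C.subtype ⊓ U := ⟨hxJ, x.2⟩
      rw [hU.inf_eq_bot, Submodule.mem_bot] at this
      exact Subtype.ext this))
  refine ⟨n, fun m => f (b m), fun m => hfC _, hb, fun c hc => ?_⟩
  obtain ⟨k, hk, y, hy, hky⟩ := Submodule.mem_sup.1
    (hU.sup_eq_top ▸ Submodule.mem_top : (⟨c, hc⟩ : C) ∈ J.comap C.subtype ⊔ U)
  obtain rfl : (k : M) + y = c := congrArg Subtype.val hky
  have hy' : (y : M) = ∑ m, b.repr ⟨y, hy⟩ m • f (b m) := by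
    change f ⟨y, hy⟩ = _
    conv_lhs => rw [← b.sum_repr ⟨y, hy⟩]
    rw [map_sum]
    simp
  have hcoef : ∀ m, B (f (b m)) ((k : M) + y) = b.repr ⟨y, hy⟩ m := by
    intro m
    have h : ∀ i, B (f (b m)) (f (b i)) = if m = i then 1 else 0 := hb m
    rw [map_add, hJ _ (hfC _) _ k.2 hk, hy', map_sum]
    simp [h]
  simp only [hcoef]
  rw [← hy', add_sub_cancel_right]
  exact hk

/-- The space is C modulo C ∩ J with inner product φ(b*c). Multiplication by x_k may leave C, so it
is compressed back; this is harmless because p and L involve only one multiplication between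
elements of C. -/
theorem exists_representation_of_state {L : MPoly g ν ν} (hL : IsLinearPencil L)
    {C : Submodule ℝ (MPoly g 1 l)} (hC : IsRightChipSpace C) (hfull : IsFull C)
    [FiniteDimensional ℝ C] (J : Submodule (Poly g) (MPoly g 1 l)) (φ : MPoly g l l →ₗ[ℝ] ℝ)
    (hsymm : ∀ q, φ qᴴ = φ q)
    (hJ : ∀ b ∈ C, ∀ ι ∈ degOneMul C, ι ∈ J → φ (bᴴ * ι) = 0)
    (hpos : ∀ c ∈ C, c ∉ J → 0 < φ (cᴴ * c))
    (hLpos : ∀ q : MPoly g ν l, RowsIn (C : Set (MPoly g 1 l)) q → 0 ≤ φ (qᴴ * L * q)) :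
    ∃ (n : ℕ) (X : Fin g → Matrix (Fin n) (Fin n) ℝ) (v : Fin l × Fin n → ℝ),
      (∀ k, (X k).IsSymm) ∧ (∀ ι ∈ degOneMul C, ι ∈ J → ι ∈ annihilator X v) ∧
      (evalAt X L).PosSemidef ∧
      ((∀ q : MPoly g ν l, RowsIn (C : Set (MPoly g 1 l)) q →
        ¬ RowsIn (J : Set (MPoly g 1 l)) q → 0 < φ (qᴴ * L * q)) → (evalAt X L).PosDef) ∧
      ∀ p ∈ starDegOneMul C, v ⬝ᵥ (evalAt X p *ᵥ v) = φ p := by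
  have hform : ∀ a b : MPoly g 1 l, φ (aᴴ * b) = φ (bᴴ * a) := by
    intro a b
    rw [← hsymm]
    simp
  obtain ⟨n, u, huC, hortho, hres⟩ := exists_orthonormal_modulo (starForm (ν := 1) φ) hform C
    (J.restrictScalars ℝ) (fun b hb c hc hcJ => hJ b hb c (le_degOneMul C hc) hcJ) hpos
  simp only [starForm_apply, Submodule.restrictScalars_mem] at hortho hres
  let Φ : MPoly g 1 l →ₗ[ℝ] (Fin n → ℝ) := LinearMap.pi fun m => starForm φ (u m)
  have hΦ : ∀ c m, Φ c m = φ ((u m)ᴴ * c) := fun c m => rfl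
  let X : Fin g → Matrix (Fin n) (Fin n) ℝ := fun k =>
    Matrix.of fun i j => φ ((u i)ᴴ * ((FreeAlgebra.ι ℝ k : Poly g) • u j))
  have hX : ∀ k, (X k).IsSymm := by
    intro k
    ext i j
    simp only [X, Matrix.transpose_apply, Matrix.of_apply]
    rw [hform, conjTranspose_smul_mul, FreeAlgebra.star_ι]
  -- The difference between `c` and its orthonormal expansion lies in C ∩ J. Multiplication by `d`
  -- keeps it in J and in the degree-one space, where φ is assumed to vanish.
  have expand : ∀ d ∈ degLE g 1, ∀ b ∈ C, ∀ c ∈ C,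
      φ (bᴴ * (d • c)) = ∑ j, φ (bᴴ * (d • u j)) * Φ c j := by
    intro d hd b hb c hc
    have h0 : φ (bᴴ * (d • (c - ∑ m, Φ c m • u m))) = 0 := by
      refine hJ b hb _ (smul_mem_degOneMul hd (C.sub_mem hc (C.sum_mem fun m _ =>
        C.smul_mem _ (huC m)))) (J.smul_mem d (hres c hc))
    rw [smul_sub, Matrix.mul_sub, map_sub, sub_eq_zero] at h0
    rw [h0, Finset.smul_sum, Matrix.mul_sum, map_sum]
    refine Finset.sum_congr rfl fun m _ => ?_
    rw [smul_comm, Matrix.mul_smul, map_smul, smul_eq_mul, mul_comm]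
  have hlift : ∀ d ∈ degLE g 1, ∀ c ∈ C, FreeAlgebra.lift ℝ X d *ᵥ Φ c = Φ (d • c) := by
    intro d hd c hc
    refine degLE_one_induction (motive := fun d => FreeAlgebra.lift ℝ X d *ᵥ Φ c = Φ (d • c))
      ?_ (fun k => ?_) (fun a b ha hb => ?_) (fun r a ha => ?_) hd
    · simp
    · ext m
      rw [FreeAlgebra.lift_ι_apply, hΦ, expand _ (ι_mem_degLE k) _ (huC m) c hc]
      rfl
    · rw [map_add, Matrix.add_mulVec, ha, hb, add_smul, map_add]
    · rw [map_smul, Matrix.smul_mulVec, ha, smul_assoc, Φ.map_smul]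
  classical
  -- The default 0 is never seen on C: by fullness, if e_i is not in C then no monomial e_i ⊗ w is.
  let v : Fin l × Fin n → ℝ := fun im => if mono im.1 [] ∈ C then Φ (mono im.1 []) im.2 else 0
  have hmono : ∀ i w, mono i w ∈ C → act X v (mono i w) = Φ (mono i w) := by
    intro i w
    induction w with
    | nil =>
      intro h
      rw [act_mono_nil]
      ext m
      simp [v, h]
    | cons k w ih =>
      intro h
      have hw : mono i w ∈ C := hfull i [k] w h
      rw [mono_cons, act_polySmul, ih hw, hlift _ (ι_mem_degLE k) _ hw]
  have hactC : ∀ c ∈ C, act X v c = Φ c := by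
    obtain ⟨S, hS⟩ := hC.spanned
    intro c hc
    have hS' : Set.EqOn (act X v) Φ ((fun m : Fin l × List (Fin g) => mono m.1 m.2) '' S) := by
      rintro _ ⟨m, hm, rfl⟩
      exact hmono _ _ (hS ▸ Submodule.subset_span ⟨m, hm, rfl⟩)
    exact LinearMap.eqOn_span hS' (hS ▸ hc)
  have hactD : ∀ c ∈ degOneMul C, act X v c = Φ c := by
    intro c hc
    refine LinearMap.eqOn_span (f := act X v) (g := Φ) ?_ hc
    rintro _ ⟨d, hd, c, hc, rfl⟩
    rw [act_polySmul, hactC c hc, hlift d hd c hc]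
  have hdot : ∀ d ∈ degLE g 1, ∀ b ∈ C, ∀ c ∈ C, Φ b ⬝ᵥ Φ (d • c) = φ (bᴴ * (d • c)) := by
    intro d hd b hb c hc
    rw [hform, conjTranspose_smul_mul, expand _ (star_mem_degLE_one hd) c hc b hb]
    refine Finset.sum_congr rfl fun j _ => ?_
    rw [hΦ (d • c), hform (u j), conjTranspose_smul_mul, mul_comm]
  -- Each block of `w` gives the coordinates of a row in C, so the quadratic form of L(X) is exactly
  -- `q ↦ φ (qᴴ * L * q)`.
  have hLform : ∀ w : Fin ν × Fin n → ℝ, ∃ q : MPoly g ν l, RowsIn (C : Set (MPoly g 1 l)) q ∧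
      (∀ a m, Φ (rowOf q a) m = w (a, m)) ∧ w ⬝ᵥ (evalAt X L *ᵥ w) = φ (qᴴ * L * q) := by
    intro w
    let c : Fin ν → MPoly g 1 l := fun a => ∑ m, w (a, m) • u m
    have hc : ∀ a, c a ∈ C := fun a => C.sum_mem fun m _ => C.smul_mem _ (huC m)
    have hΦc : ∀ a, Φ (c a) = fun m => w (a, m) := by
      intro a
      ext m
      simp [hΦ, c, Matrix.mul_sum, hortho]
    let q : MPoly g ν l := Matrix.of fun a => c a 0
    have hq : ∀ a, rowOf q a = c a := by
      intro a
      ext i j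
      obtain rfl : i = 0 := Subsingleton.elim _ _
      rfl
    refine ⟨q, fun a => by rw [hq]; exact hc a, fun a m => by rw [hq, hΦc], ?_⟩
    rw [Matrix.mul_assoc, conjTranspose_mul_eq_sum_rowOf, map_sum]
    simp only [rowOf_mul, hq, Matrix.mul_sum, map_sum]
    rw [dotProduct, Fintype.sum_prod_type]
    refine Finset.sum_congr rfl fun a _ => ?_
    simp only [evalAt_mulVec_apply, Finset.mul_sum]
    rw [Finset.sum_comm]
    refine Finset.sum_congr rfl fun b _ => ?_
    rw [← hdot _ (hL.deg_le_one a b) _ (hc a) _ (hc b),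
      ← hlift _ (hL.deg_le_one a b) _ (hc b), hΦc, hΦc]
    rfl
  have hherm : (evalAt X L).IsHermitian := by
    rw [Matrix.IsHermitian, Matrix.conjTranspose_eq_transpose_of_trivial,
      ← evalAt_conjTranspose hX, hL.symm]
  refine ⟨n, X, v, hX, fun ι hι hιJ => ?_, ?_, fun hstrict => ?_, fun p hp => ?_⟩
  · refine mem_annihilator.2 (act_eq_zero_iff.1 ?_)
    rw [hactD ι hι]
    ext m
    exact hJ _ (huC m) ι hι hιJ
  · refine Matrix.PosSemidef.of_dotProduct_mulVec_nonneg hherm fun w => ?_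
    obtain ⟨q, hq, -, hw⟩ := hLform w
    rw [star_trivial, hw]
    exact hLpos q hq
  · refine Matrix.PosDef.of_dotProduct_mulVec_pos hherm fun w hw0 => ?_
    obtain ⟨q, hq, hqw, hw⟩ := hLform w
    rw [star_trivial, hw]
    refine hstrict q hq fun hqJ => hw0 ?_
    ext ⟨a, m⟩
    rw [← hqw]
    exact hJ _ (huC m) _ (le_degOneMul C (hq a)) (hqJ a)
  · induction hp using Submodule.span_induction with
    | mem x h =>
      obtain ⟨b, hb, d, hd, c, hc, rfl⟩ := h
      rw [dotProduct_evalAt_conjTranspose_mul hX, ← hdot d hd b hb c hc, ← hactC b hb,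
        ← hactD _ (smul_mem_degOneMul hd hc), dotProduct, Fintype.sum_prod_type]
      simp [act_apply, dotProduct]
    | zero => simp [evalAt_zero]
    | add x y _ _ hx hy => rw [evalAt_add, Matrix.add_mulVec, dotProduct_add, hx, hy, map_add]
    | smul r x _ hx => rw [evalAt_smul, Matrix.smul_mulVec, dotProduct_smul, hx, map_smul]

/-! ### Cross terms and the separating functional. -/

/-- The subspace `ℝ^{ν × 1} S` of the matrices all of whose rows lie in `S`. -/
def rowsSubmodule (ν : ℕ) (S : Submodule ℝ (MPoly g 1 l)) : Submodule ℝ (MPoly g ν l) where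
  carrier := {q | RowsIn (S : Set (MPoly g 1 l)) q}
  add_mem' ha hb i := S.add_mem (ha i) (hb i)
  zero_mem' _ := S.zero_mem
  smul_mem' r _ ha i := S.smul_mem r (ha i)

instance (S : Submodule ℝ (MPoly g 1 l)) [FiniteDimensional ℝ S] :
    FiniteDimensional ℝ (rowsSubmodule ν S) := by
  let f : rowsSubmodule ν S →ₗ[ℝ] (Fin ν → S) :=
    { toFun := fun q i => ⟨rowOf q i, q.2 i⟩
      map_add' := fun _ _ => rfl
      map_smul' := fun _ _ => rfl }
  refine FiniteDimensional.of_injective f fun q q' h => ?_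
  ext i j
  exact congrArg (fun x : S => (x : MPoly g 1 l) 0 j) (congrFun h i)

/-- The span of all `b* ι + ι* b` with `b ∈ C` and `ι ∈ J ∩ ℝ⟨x⟩_1 C`. -/
def crossSpan (C : Submodule ℝ (MPoly g 1 l)) (J : Submodule (Poly g) (MPoly g 1 l)) :
    Submodule ℝ (MPoly g l l) :=
  Submodule.span ℝ {s | ∃ b ∈ C, ∃ t, (t ∈ J ∧ t ∈ degOneMul C) ∧ s = bᴴ * t + tᴴ * b}

theorem exists_sum_of_mem_crossSpan {C : Submodule ℝ (MPoly g 1 l)}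
    {J : Submodule (Poly g) (MPoly g 1 l)} {s : MPoly g l l} (hs : s ∈ crossSpan C J) :
    ∃ (c : ℕ) (R T : Fin c → MPoly g 1 l), (∀ k, R k ∈ C) ∧ (∀ k, T k ∈ J ∧ T k ∈ degOneMul C) ∧
      s = ∑ k, ((R k)ᴴ * T k + (T k)ᴴ * R k) := by
  obtain ⟨c, f, y, rfl⟩ := Submodule.mem_span_set'.1 hs
  choose b hb t ht hy using fun k => (y k).2
  refine ⟨c, fun k => f k • b k, t, fun k => C.smul_mem _ (hb k), ht, ?_⟩
  refine Finset.sum_congr rfl fun k _ => ?_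
  rw [hy]
  simp

theorem inRowsAddStar_of_mem_crossSpan {C : Submodule ℝ (MPoly g 1 l)}
    {J : Submodule (Poly g) (MPoly g 1 l)} {s : MPoly g l l} (hs : s ∈ crossSpan C J) :
    InRowsAddStar J s := by
  obtain ⟨c, R, T, -, hT, rfl⟩ := exists_sum_of_mem_crossSpan hs
  have hrow : ∀ i, rowOf (∑ k, (R k)ᴴ * T k) i ∈ J := by
    intro i
    have : rowOf (∑ k, (R k)ᴴ * T k) i = ∑ k, star (R k 0 i) • T k := by
      ext a j
      obtain rfl : a = 0 := Subsingleton.elim _ _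
      simp [rowOf, Matrix.mul_apply, Matrix.sum_apply]
    rw [this]
    exact J.sum_mem fun k _ => J.smul_mem _ (hT k).1
  refine ⟨_, _, hrow, hrow, ?_⟩
  simp [Matrix.conjTranspose_sum, Finset.sum_add_distrib]

theorem conjTranspose_mul_add_mem_crossSpan {C : Submodule ℝ (MPoly g 1 l)}
    {J : Submodule (Poly g) (MPoly g 1 l)} {b t : MPoly g ν l}
    (hb : RowsIn (C : Set (MPoly g 1 l)) b) (htJ : RowsIn (J : Set (MPoly g 1 l)) t)
    (htC : RowsIn (degOneMul C : Set (MPoly g 1 l)) t) : bᴴ * t + tᴴ * b ∈ crossSpan C J := by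
  rw [conjTranspose_mul_eq_sum_rowOf, conjTranspose_mul_eq_sum_rowOf, ← Finset.sum_add_distrib]
  exact Submodule.sum_mem _ fun a _ =>
    Submodule.subset_span ⟨_, hb a, _, ⟨htJ a, htC a⟩, rfl⟩

theorem mem_crossSpan_of_isHermitian {C : Submodule ℝ (MPoly g 1 l)}
    {J : Submodule (Poly g) (MPoly g 1 l)} {b t : MPoly g ν l}
    (hb : RowsIn (C : Set (MPoly g 1 l)) b) (htJ : RowsIn (J : Set (MPoly g 1 l)) t)
    (htC : RowsIn (degOneMul C : Set (MPoly g 1 l)) t) (h : tᴴ * b = bᴴ * t) :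
    bᴴ * t ∈ crossSpan C J := by
  have := Submodule.smul_mem _ (2⁻¹ : ℝ) (conjTranspose_mul_add_mem_crossSpan hb htJ htC)
  rwa [h, ← two_smul ℝ, smul_smul, inv_mul_cancel₀ two_ne_zero, one_smul] at this

/-- The quadratic map `(a, q) ↦ a* a + q* L q`, polarized. -/
def squareForm (L : MPoly g ν ν) :
    (MPoly g 1 l × MPoly g ν l) →ₗ[ℝ] (MPoly g 1 l × MPoly g ν l) →ₗ[ℝ] MPoly g l l :=
  LinearMap.mk₂ ℝ (fun x y => x.1ᴴ * y.1 + x.2ᴴ * L * y.2)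
    (by intros; simp [Matrix.add_mul]; abel) (by intros; simp)
    (by intros; simp [Matrix.mul_add]; abel) (by intros; simp)

theorem squareForm_apply (L : MPoly g ν ν) (x y : MPoly g 1 l × MPoly g ν l) :
    squareForm L x y = x.1ᴴ * y.1 + x.2ᴴ * L * y.2 := rfl

/-- Every term involving `k` pairs an element of C with one of J of degree one over C; the pure `k`
terms are Hermitian, hence half of such a symmetrized pair. -/
theorem squareForm_add_self_sub_mem_crossSpan {L : MPoly g ν ν} (hL : IsLinearPencil L)
    {C : Submodule ℝ (MPoly g 1 l)} {J : Submodule (Poly g) (MPoly g 1 l)}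
    {x k : MPoly g 1 l × MPoly g ν l} (hx1 : x.1 ∈ C) (hx2 : RowsIn (C : Set (MPoly g 1 l)) x.2)
    (hk1 : k.1 ∈ C) (hk2 : RowsIn (C : Set (MPoly g 1 l)) k.2) (hk1J : k.1 ∈ J)
    (hk2J : RowsIn (J : Set (MPoly g 1 l)) (L * k.2)) :
    squareForm L (x + k) (x + k) - squareForm L x x ∈ crossSpan C J := by
  have hrow : ∀ {S : Set (MPoly g 1 l)} {c : MPoly g 1 l}, c ∈ S → RowsIn S c := by
    intro S c hc i
    obtain rfl : i = 0 := Subsingleton.elim _ _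
    convert hc
    ext a j
    obtain rfl : a = 0 := Subsingleton.elim _ _
    rfl
  have hkD := rowsIn_degOneMul_mul hL hk2
  have h1 := conjTranspose_mul_add_mem_crossSpan (hrow hx1 : RowsIn (C : Set _) _)
    (hrow hk1J : RowsIn (J : Set _) _) (hrow (le_degOneMul C hk1))
  have h2 := mem_crossSpan_of_isHermitian (hrow hk1 : RowsIn (C : Set _) _)
    (hrow hk1J : RowsIn (J : Set _) _) (hrow (le_degOneMul C hk1)) rfl
  have h3 := conjTranspose_mul_add_mem_crossSpan hx2 hk2J hkD
  have h4 := mem_crossSpan_of_isHermitian hk2 hk2J hkD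
    (by rw [Matrix.conjTranspose_mul, hL.symm, Matrix.mul_assoc])
  convert Submodule.add_mem _ (Submodule.add_mem _ h1 h2) (Submodule.add_mem _ h3 h4) using 1
  simp only [squareForm_apply, Prod.fst_add, Prod.snd_add, Matrix.conjTranspose_add,
    Matrix.conjTranspose_mul, hL.symm, Matrix.add_mul, Matrix.mul_add, Matrix.mul_assoc]
  abel

/-- `N` treats both notions of reality at once: it consists of the `q` that the reality condition
considers trivial. -/
theorem exists_state_of_not_hasCertificate {L : MPoly g ν ν} (hL : IsLinearPencil L)
    {C : Submodule ℝ (MPoly g 1 l)} [FiniteDimensional ℝ C]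
    (J : Submodule (Poly g) (MPoly g 1 l)) (N : Submodule ℝ (MPoly g ν l))
    (hN : ∀ q ∈ N, RowsIn (J : Set (MPoly g 1 l)) (L * q))
    (hreal : ∀ (a b : ℕ) (P : Fin a → MPoly g 1 l) (Q : Fin b → MPoly g ν l),
      (∀ i, P i ∈ C) → (∀ j, RowsIn (C : Set (MPoly g 1 l)) (Q j)) →
      InRowsAddStar J (∑ i, (P i)ᴴ * P i + ∑ j, (Q j)ᴴ * L * Q j) →
      (∀ i, P i ∈ J) ∧ ∀ j, Q j ∈ N)
    {p : MPoly g l l} (hsymm : pᴴ = p) (hp : ¬ HasCertificate L C J p) :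
    ∃ φ : MPoly g l l →ₗ[ℝ] ℝ, (∀ q, φ qᴴ = φ q) ∧
      (∀ b ∈ C, ∀ t ∈ degOneMul C, t ∈ J → φ (bᴴ * t) = 0) ∧
      (∀ c ∈ C, c ∉ J → 0 < φ (cᴴ * c)) ∧
      (∀ q : MPoly g ν l, RowsIn (C : Set (MPoly g 1 l)) q → 0 ≤ φ (qᴴ * L * q)) ∧
      (∀ q : MPoly g ν l, RowsIn (C : Set (MPoly g 1 l)) q → q ∉ N → 0 < φ (qᴴ * L * q)) ∧
      φ p < 0 := by
  let W := crossSpan C J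
  let i : (C × rowsSubmodule ν C) →ₗ[ℝ] (MPoly g 1 l × MPoly g ν l) :=
    C.subtype.prodMap (rowsSubmodule ν C).subtype
  have hi1 : ∀ x, (i x).1 ∈ C := fun x => x.1.2
  have hi2 : ∀ x, RowsIn (C : Set (MPoly g 1 l)) (i x).2 := fun x => x.2.2
  let B := ((squareForm L).compl₁₂ i i).compr₂ W.mkQ
  have hB : ∀ x y, B x y = W.mkQ (squareForm L (i x) (i y)) := fun _ _ => rfl
  let K : Submodule ℝ (C × rowsSubmodule ν C) := ((J.restrictScalars ℝ).prod N).comap i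
  have hsum : ∀ (m : ℕ) (v : Fin m → C × rowsSubmodule ν C), ∑ k, B (v k) (v k) =
      W.mkQ (∑ k, ((i (v k)).1)ᴴ * (i (v k)).1 + ∑ k, ((i (v k)).2)ᴴ * L * (i (v k)).2) := by
    intro m v
    simp only [hB, ← map_sum, squareForm_apply, Finset.sum_add_distrib]
  obtain ⟨φ, hφpos, hφp⟩ := exists_functional_pos_of_quadratic B K (fun x k hk => by
      rw [hB, hB, ← sub_eq_zero, ← map_sub, map_add, Submodule.mkQ_apply,
        Submodule.Quotient.mk_eq_zero]
      exact squareForm_add_self_sub_mem_crossSpan hL (hi1 x) (hi2 x) (hi1 k) (hi2 k) hk.1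
        (hN _ hk.2))
    (fun m v h => by
      rw [hsum, Submodule.mkQ_apply, Submodule.Quotient.mk_eq_zero] at h
      obtain ⟨h1, h2⟩ := hreal m m _ _ (fun k => hi1 (v k)) (fun k => hi2 (v k))
        (inRowsAddStar_of_mem_crossSpan h)
      exact fun k => ⟨h1 k, h2 k⟩)
    (W.mkQ p) (fun m v h => hp (by
      rw [hsum, ← sub_eq_zero, ← map_sub, Submodule.mkQ_apply,
        Submodule.Quotient.mk_eq_zero] at h
      obtain ⟨c, R, T, hR, hT, hRT⟩ := exists_sum_of_mem_crossSpan h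
      exact ⟨m, m, c, _, _, R, T, fun k => hi1 (v k), fun k => hi2 (v k), hR, hT,
        (sub_eq_iff_eq_add'.1 hRT)⟩))
  -- φ kills only the symmetrized terms b*t + t*b. Symmetrizing makes the functional kill b*t alone
  -- and doubles its values on symmetric elements.
  let ψ : MPoly g l l →ₗ[ℝ] ℝ :=
    { toFun := fun q => φ (W.mkQ (q + qᴴ))
      map_add' := fun a b => by
        rw [← map_add, ← map_add, Matrix.conjTranspose_add, add_add_add_comm]
      map_smul' := fun r a => by
        rw [Matrix.conjTranspose_smul, star_trivial, ← smul_add, map_smul, map_smul]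
        rfl }
  have hψ : ∀ q, ψ q = φ (W.mkQ (q + qᴴ)) := fun _ => rfl
  have hψsymm : ∀ q : MPoly g l l, qᴴ = q → ψ q = 2 * φ (W.mkQ q) := by
    intro q hq
    rw [hψ, hq, map_add, map_add, two_mul]
  have hW : ∀ q ∈ W, φ (W.mkQ q) = 0 := by
    intro q hq
    rw [Submodule.mkQ_apply, (Submodule.Quotient.mk_eq_zero W).2 hq, map_zero]
  have hLq : ∀ q : MPoly g ν l, (qᴴ * L * q)ᴴ = qᴴ * L * q := by
    intro q
    simp [hL.symm, Matrix.mul_assoc]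
  have hstrict : ∀ q : MPoly g ν l, RowsIn (C : Set (MPoly g 1 l)) q → q ∉ N →
      0 < ψ (qᴴ * L * q) := by
    intro q hq hqN
    have := hφpos (0, ⟨q, hq⟩) fun h => hqN h.2
    have h2 : B (0, ⟨q, hq⟩) (0, ⟨q, hq⟩) = W.mkQ (qᴴ * L * q) := by
      simp [hB, i, squareForm_apply]
    rw [h2] at this
    rw [hψsymm _ (hLq q)]
    linarith
  refine ⟨ψ, fun q => ?_, fun b hb t ht htJ => ?_, fun c hc hcJ => ?_, fun q hq => ?_, hstrict, ?_⟩
  · rw [hψ, hψ, Matrix.conjTranspose_conjTranspose, add_comm]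
  · rw [hψ]
    refine hW _ (Submodule.subset_span ⟨b, hb, t, ⟨htJ, ht⟩, ?_⟩)
    simp
  · have := hφpos (⟨c, hc⟩, 0) fun h => hcJ h.1
    have h2 : B (⟨c, hc⟩, 0) (⟨c, hc⟩, 0) = W.mkQ (cᴴ * c) := by
      simp [hB, i, squareForm_apply]
    rw [h2] at this
    rw [hψsymm _ (by simp)]
    linarith
  · by_cases hqN : q ∈ N
    · rw [hψsymm _ (hLq q), hW, mul_zero]
      rw [Matrix.mul_assoc]
      exact mem_crossSpan_of_isHermitian hq (hN q hqN) (rowsIn_degOneMul_mul hL hq)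
        (by rw [Matrix.conjTranspose_mul, hL.symm, Matrix.mul_assoc])
    · exact (hstrict q hq hqN).le
  · rw [hψsymm p hsymm]
    linarith

/-! ### Points of V(I) and the two equivalences. -/

theorem mem_zeroSet_of_le_annihilator {X : Fin g → Matrix (Fin n) (Fin n) ℝ}
    (hX : ∀ k, (X k).IsSymm) {v : Fin l × Fin n → ℝ} {I : Submodule (Poly g) (MPoly g 1 l)}
    (hI : I ≤ annihilator X v) : (X, v) ∈ zeroSet (I : Set (MPoly g 1 l)) n :=
  ⟨hX, fun _ hp => mem_annihilator.1 (hI hp)⟩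

theorem le_annihilator_of_mem_zeroSet {X : Fin g → Matrix (Fin n) (Fin n) ℝ}
    {v : Fin l × Fin n → ℝ} {I : Submodule (Poly g) (MPoly g 1 l)}
    (h : (X, v) ∈ zeroSet (I : Set (MPoly g 1 l)) n) : I ≤ annihilator X v :=
  fun p hp => mem_annihilator.2 (h.2 p hp)

end SymmNC

end

theorem theorem8 {g ν l : ℕ} (L : SymmNC.MPoly g ν ν) (hL : SymmNC.IsLinearPencil L)
    (C : Submodule ℝ (SymmNC.MPoly g 1 l)) (hC : SymmNC.IsRightChipSpace C)
    (hfull : SymmNC.IsFull C) (hfin : FiniteDimensional ℝ C)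
    (I : Submodule (SymmNC.Poly g) (SymmNC.MPoly g 1 l))
    (hI : ∃ S : Set (SymmNC.MPoly g 1 l), S ⊆ SymmNC.degOneMul C ∧
      I = Submodule.span (SymmNC.Poly g) S)
    (p : SymmNC.MPoly g l l) (hp : p ∈ SymmNC.starDegOneMul C) (hsymm : pᴴ = p) :
    ((∀ (n : ℕ) (X : Fin g → Matrix (Fin n) (Fin n) ℝ) (v : Fin l × Fin n → ℝ),
        (X, v) ∈ SymmNC.zeroSet (I : Set (SymmNC.MPoly g 1 l)) n →
        (SymmNC.evalAt X L).PosSemidef → 0 ≤ v ⬝ᵥ (SymmNC.evalAt X p *ᵥ v)) ↔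
      SymmNC.HasCertificate L C (SymmNC.realRadical L C I) p) ∧
    ((∀ (n : ℕ) (X : Fin g → Matrix (Fin n) (Fin n) ℝ) (v : Fin l × Fin n → ℝ),
        (X, v) ∈ SymmNC.zeroSet (I : Set (SymmNC.MPoly g 1 l)) n →
        (SymmNC.evalAt X L).PosDef → 0 ≤ v ⬝ᵥ (SymmNC.evalAt X p *ᵥ v)) ↔
      SymmNC.HasCertificate L C (SymmNC.strongRealRadical L C I) p) := by
  obtain ⟨S, hSC, hSI⟩ := hI
  refine ⟨⟨fun h => ?_, fun h n X v hXv hLX => ?_⟩, ⟨fun h => ?_, fun h n X v hXv hLX => ?_⟩⟩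
  · by_contra hcert
    have hIJ : I ≤ SymmNC.realRadical L C I := le_sInf fun _ hJ => hJ.1
    obtain ⟨φ, hφ, hφJ, hφC, hφL, -, hφp⟩ := SymmNC.exists_state_of_not_hasCertificate hL
      (SymmNC.realRadical L C I)
      ((SymmNC.rowsSubmodule ν ((SymmNC.realRadical L C I).restrictScalars ℝ)).comap
        ({ toFun := fun q => L * q
           map_add' := Matrix.mul_add L
           map_smul' := fun r q => Matrix.mul_smul L r q } :
          SymmNC.MPoly g ν l →ₗ[ℝ] SymmNC.MPoly g ν l))
      (fun q hq => hq) (SymmNC.isReal_realRadical L C I) hsymm hcert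
    obtain ⟨n, X, v, hX, hann, hLX, -, hval⟩ :=
      SymmNC.exists_representation_of_state hL hC hfull _ φ hφ hφJ hφC hφL
    -- Vanishing at (X, v) is known only for elements of J of degree one over C; the generators of I
    -- are such, and the annihilator is a left module.
    have hle : I ≤ SymmNC.annihilator X v := by
      rw [hSI, Submodule.span_le]
      exact fun s hs => hann s (hSC hs) (hIJ (hSI ▸ Submodule.subset_span hs))
    have := h n X v (SymmNC.mem_zeroSet_of_le_annihilator hX hle) hLX
    rw [hval p hp] at this
    exact this.not_gt hφp
  · exact h.dotProduct_nonneg hXv.1 hLX (sInf_le <| Set.mem_ofPred.2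
      ⟨SymmNC.le_annihilator_of_mem_zeroSet hXv, SymmNC.isReal_annihilator hXv.1 v hLX C⟩)
  · by_contra hcert
    have hIJ : I ≤ SymmNC.strongRealRadical L C I := le_sInf fun _ hJ => hJ.1
    obtain ⟨φ, hφ, hφJ, hφC, hφL, hφL', hφp⟩ := SymmNC.exists_state_of_not_hasCertificate hL
      (SymmNC.strongRealRadical L C I)
      (SymmNC.rowsSubmodule ν ((SymmNC.strongRealRadical L C I).restrictScalars ℝ))
      (fun q hq a => by
        rw [SymmNC.rowOf_mul]
        exact Submodule.sum_mem _ fun b _ => Submodule.smul_mem _ _ (hq b))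
      (SymmNC.isStronglyReal_strongRealRadical L C I) hsymm hcert
    obtain ⟨n, X, v, hX, hann, -, hLX, hval⟩ :=
      SymmNC.exists_representation_of_state hL hC hfull _ φ hφ hφJ hφC hφL
    have hle : I ≤ SymmNC.annihilator X v := by
      rw [hSI, Submodule.span_le]
      exact fun s hs => hann s (hSC hs) (hIJ (hSI ▸ Submodule.subset_span hs))
    have := h n X v (SymmNC.mem_zeroSet_of_le_annihilator hX hle) (hLX hφL')
    rw [hval p hp] at this
    exact this.not_gt hφp
  · exact h.dotProduct_nonneg hXv.1 hLX.posSemidef (sInf_le <| Set.mem_ofPred.2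
      ⟨SymmNC.le_annihilator_of_mem_zeroSet hXv, SymmNC.isStronglyReal_annihilator hXv.1 v hLX C⟩)
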